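/- Let $k,m\ge 1$. On the Hurwitz space $H_{0,k+m}(k,m)$ of rational functions $\mathbb P^1\to\mathbb P^1$ of degree $k+m$ with two poles, of orders $k$ and $m$, and with simple finite ramification points having distinct images, take the superpotential $$\lambda(\hat p)=\frac{\prod_{i=1}^{k+m}(\hat p-\hat z^i)}{(\hat p-\hat z^0)^m},\qquad m\hat z^0=\sum_{i=1}^{k+m}\hat z^i ,$$ with primary differential $d\hat p$. Off the discriminant (that is, where the zeros $\hat z^1,\dots,\hat z^{k+m}$ of $\lambda$ are distinct) use $\hat z^1,\dots,\hat z^{k+m}$ as local coordinates. The metric and the multiplication are given by $$\langle\partial',\partial''\rangle=-\sum\operatorname*{res}_{d\lambda=0}\frac{\partial'\lambda\,\partial''\lambda}{\lambda'(\hat p)}d\hat p,\qquad \langle\partial'\circ\partial'',\partial'''\rangle=-\sum\operatorname*{res}_{d\lambda=0}\frac{\partial'\lambda\,\partial''\lambda\,\partial'''\lambda}{\lambda'(\hat p)}d\hat p ,$$ with Euler field $E=\frac1k\sum_i\hat z^i\partial_{\hat z^i}$. Let $E^{-1}$ be the inverse of $E$ for $\circ$, let $X\star Y=E^{-1}\circ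 X\circ Y$ be the dual multiplication, and let $(X,Y)=\langle E^{-1}\circ X,Y\rangle$ be the intersection form. A dual prepotential is a holomorphic function whose third derivatives in flat coordinates of $(\,,)$ are the structure functions $(\partial_i\star\partial_j,\partial_l)$. Then $\langle\,,\rangle$ is nondegenerate, $E^{-1}$ exists, the $\hat z^1,\dots,\hat z^{k+m}$ are flat coordinates of the nondegenerate form $(\,,)$, and in these coordinates, on every open set on which branches of the logarithms are chosen, $$\hat F^\star=\frac14\sum_{0\le i<j\le k+m}\alpha_i\alpha_j(\hat z^i-\hat z^j)^2\log(\hat z^i-\hat z^j)^2\Big|_{m\hat z^0=\sum_{i=1}^{k+m}\hat z^i},\qquad \alpha_0=-m,\quad \alpha_i=1\ (i>0),$$ is a dual prepotential; on a connected open set every dual prepotential differs from it by a polynomial of degree at most two in the $\hat z^i$. -/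

import Mathlib

open scoped Topology

namespace HurwitzDual

/-- The coordinate space of the ordered zeros `z^1, …, z^{k+m}` of the superpotential
(listed by `Fin (k + m)`); it is also the space of tangent vectors at each point. -/
abbrev Pt (k m : ℕ) : Type := Fin (k + m) → ℂ

/-- The coordinate vector field `∂_i = ∂/∂z^i`. -/
noncomputable def basisVec (k m : ℕ) (i : Fin (k + m)) : Pt k m := Pi.single i 1

/-- The finite pole `z^0` of the superpotential, given by `m z^0 = z^1 + ⋯ + z^{k+m}`. -/
noncomputable def pole (k m : ℕ) (z : Pt k m) : ℂ := (∑ i, z i) / (m : ℂ)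

/-- The superpotential `λ(p) = ∏ (p - z^i) / (p - z^0)^m`. -/
noncomputable def superpot (k m : ℕ) (z : Pt k m) (p : ℂ) : ℂ :=
  (∏ i, (p - z i)) / (p - pole k m z) ^ m

/-- The derivative `∂_X λ (p)` of the superpotential along the tangent vector `X` at `z`,
the variable `p` being kept fixed (the primary differential is `dp`). -/
noncomputable def dSuper (k m : ℕ) (z X : Pt k m) (p : ℂ) : ℂ :=
  fderiv ℂ (fun w : Pt k m => superpot k m w p) z X

/-- The finite ramification points of `λ`, i.e. the zeros of `dλ`. -/
def critPts (k m : ℕ) (z : Pt k m) : Set ℂ :=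
  {c | c ≠ pole k m z ∧ deriv (superpot k m z) c = 0}

/-- The part of the Hurwitz space `H_{0,k+m}(k,m)` off the discriminant, in the coordinates `z`.
A class of covers is represented by its superpotential, the parameter `p` of the Riemann sphere
being normalised by an affine change.
* `pole_ne`: the preimage of infinity is `{∞, z^0}`, with ramification indices `k` and `m`;
* `simple`, `distinct`: the finite ramification points are simple and have distinct images;
* `zeros_distinct`: no critical value is zero, i.e. the zeros of `λ` are distinct. -/
structure InHurwitz (k m : ℕ) (z : Pt k m) : Prop where
  pole_ne : ∀ i, z i ≠ pole k m z
  simple : ∀ c ∈ critPts k m z, deriv (deriv (superpot k m z)) c ≠ 0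
  distinct : ∀ c ∈ critPts k m z, ∀ c' ∈ critPts k m z,
    superpot k m z c = superpot k m z c' → c = c'
  zeros_distinct : Function.Injective z

/-- The residue at `c` of the differential `f(p) dp`: the value of
`(2πi)⁻¹ ∮_{|p - c| = r} f(p) dp` for small radii `r > 0`. -/
noncomputable def residue (f : ℂ → ℂ) (c : ℂ) : ℂ :=
  Filter.limUnder (𝓝[>] (0 : ℝ)) fun r => (2 * (Real.pi : ℂ) * Complex.I)⁻¹ * ∮ p in C(c, r), f p

/-- The sum of the residues of `f(p) dp` over the zeros of `dλ`. -/
noncomputable def critRes (k m : ℕ) (z : Pt k m) (f : ℂ → ℂ) : ℂ :=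
  ∑ᶠ c ∈ critPts k m z, residue f c

/-- The metric `<X, Y> = - ∑ res_{dλ = 0} ∂_Xλ ∂_Yλ / λ' dp`. -/
noncomputable def eta (k m : ℕ) (z X Y : Pt k m) : ℂ :=
  -critRes k m z fun p =>
    dSuper k m z X p * dSuper k m z Y p / deriv (superpot k m z) p

/-- The tensor `<X ∘ Y, Z> = - ∑ res_{dλ = 0} ∂_Xλ ∂_Yλ ∂_Zλ / λ' dp`. -/
noncomputable def triple (k m : ℕ) (z X Y Z : Pt k m) : ℂ :=
  -critRes k m z fun p =>
    dSuper k m z X p * dSuper k m z Y p * dSuper k m z Z p / deriv (superpot k m z) p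

/-- The components of the metric `<,>` in the coordinates `z`. -/
noncomputable def etaMatrix (k m : ℕ) (z : Pt k m) : Matrix (Fin (k + m)) (Fin (k + m)) ℂ :=
  Matrix.of fun i j => eta k m z (basisVec k m i) (basisVec k m j)

/-- The Frobenius multiplication `X ∘ Y` on the tangent space at `z`, obtained from
`<X ∘ Y, Z>` by raising the last index with the inverse of `<,>`. -/
noncomputable def circ (k m : ℕ) (z X Y : Pt k m) : Pt k m :=
  Matrix.mulVec (etaMatrix k m z)⁻¹ fun i => triple k m z X Y (basisVec k m i)

/-- The Euler vector field `E = (1/k) ∑ z^i ∂_i`. It generates the rescaling of `λ`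
(see `superpot_smul`: along its flow `z ↦ e^{t/k} z`, together with `p ↦ e^{t/k} p`,
the function `λ` is multiplied by `e^t`), so that `E u = u` for each critical value `u` of `λ`. -/
noncomputable def euler (k m : ℕ) (z : Pt k m) : Pt k m := fun i => z i / (k : ℂ)

theorem superpot_smul (k m : ℕ) (z : Pt k m) (p s : ℂ) (hs : s ≠ 0) :
    superpot k m (s • z) (s * p) = s ^ k * superpot k m z p := by
  have h1 : pole k m (s • z) = s * pole k m z := by
    simp [pole, mul_div_assoc, ← Finset.mul_sum]
  have h2 : ∀ i, s * p - (s • z) i = s * (p - z i) := fun i => by simp [mul_sub]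
  unfold superpot
  rw [h1, Finset.prod_congr rfl fun i _ => h2 i, Finset.prod_mul_distrib, ← mul_sub, mul_pow]
  simp only [Finset.prod_const, Finset.card_univ, Fintype.card_fin, pow_add]
  have h3 : s ^ m ≠ 0 := pow_ne_zero _ hs
  rw [mul_comm (s ^ k) (s ^ m), mul_assoc, mul_div_mul_left _ _ h3, mul_div_assoc]

/-- `e` is the unity of `∘` at `z`. -/
def IsUnity (k m : ℕ) (z e : Pt k m) : Prop := ∀ X : Pt k m, circ k m z e X = X

/-- `v` is the value at `z` of the vector field `E⁻¹`: `E⁻¹ ∘ E` is the unity. -/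
def IsEulerInv (k m : ℕ) (z v : Pt k m) : Prop := IsUnity k m z (circ k m z v (euler k m z))

/-- The dual multiplication `X ⋆ Y = E⁻¹ ∘ X ∘ Y`, where `v` is the value of `E⁻¹` at `z`. -/
noncomputable def star (k m : ℕ) (z v X Y : Pt k m) : Pt k m :=
  circ k m z v (circ k m z X Y)

/-- The intersection form `(X, Y) = <E⁻¹ ∘ X, Y>`, where `v` is the value of `E⁻¹` at `z`. -/
noncomputable def inter (k m : ℕ) (z v X Y : Pt k m) : ℂ :=
  eta k m z (circ k m z v X) Y

/-- The partial derivative `∂F/∂z^i`. -/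
noncomputable def pd (k m : ℕ) (i : Fin (k + m)) (F : Pt k m → ℂ) (z : Pt k m) : ℂ :=
  fderiv ℂ F z (basisVec k m i)

/-- `F` is a dual prepotential on the open set `U`: it is holomorphic, `<,>` is nondegenerate,
`E⁻¹` exists, the `z^i` are flat coordinates of the (nondegenerate) intersection form, and in
them the third derivatives of `F` are the structure functions `(∂_i ⋆ ∂_j, ∂_l)`. -/
structure IsDualPrepotential (k m : ℕ) (U : Set (Pt k m)) (F : Pt k m → ℂ) : Prop where
  analytic : AnalyticOnNhd ℂ F U
  eta_nondeg : ∀ z ∈ U, IsUnit (etaMatrix k m z).det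
  structure_eq : ∃ Einv : Pt k m → Pt k m,
    (∀ z ∈ U, IsEulerInv k m z (Einv z)) ∧
    (∃ G : Matrix (Fin (k + m)) (Fin (k + m)) ℂ, G.IsSymm ∧ IsUnit G.det ∧
      ∀ z ∈ U, ∀ i j,
        inter k m z (Einv z) (basisVec k m i) (basisVec k m j) = G i j) ∧
    ∀ z ∈ U, ∀ i j l,
      pd k m i (pd k m j (pd k m l F)) z =
        inter k m z (Einv z)
          (star k m z (Einv z) (basisVec k m i) (basisVec k m j)) (basisVec k m l)

/-- The points `z^0, z^1, …, z^{k+m}`, with `z^0` the pole. -/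
noncomputable def points (k m : ℕ) (z : Pt k m) : Fin (k + m + 1) → ℂ :=
  Fin.cons (pole k m z) z

/-- The weights `α_0 = -m` and `α_i = 1` for `i > 0`. -/
def weight (k m : ℕ) : Fin (k + m + 1) → ℂ :=
  Fin.cons (-(m : ℂ)) fun _ => 1

/-- `L i j`, for `i < j`, is a branch on `U` of `log (z^i - z^j)^2`. -/
def IsLogBranch (k m : ℕ) (U : Set (Pt k m))
    (L : Fin (k + m + 1) → Fin (k + m + 1) → Pt k m → ℂ) : Prop :=
  ∀ i j, i < j → ContinuousOn (L i j) U ∧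
    ∀ z ∈ U, Complex.exp (L i j z) = (points k m z i - points k m z j) ^ 2

/-- The function `(1/4) ∑_{i < j} α_i α_j (z^i - z^j)^2 log (z^i - z^j)^2`, restricted to
`m z^0 = z^1 + ⋯ + z^{k+m}`, for the branches `L` of the logarithms. -/
noncomputable def dualF (k m : ℕ) (L : Fin (k + m + 1) → Fin (k + m + 1) → Pt k m → ℂ)
    (z : Pt k m) : ℂ :=
  (1 / 4 : ℂ) * ∑ i, ∑ j ∈ Finset.Ioi i,
    weight k m i * weight k m j * (points k m z i - points k m z j) ^ 2 * L i j z

end HurwitzDual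

/-!
With `z^0, …, z^{k+m}` and the weights `α` the superpotential is `λ = ∏ₛ (p - zˢ) ^ αₛ`, so that
`∂_Xλ = -λ A_X` with `A_X(p) = ∑ₛ αₛ Xˢ / (p - zˢ)` (`dSuper_eq`), where `X⁰` is determined by
`m X⁰ = X¹ + ⋯ + X^{k+m}`, that is `∑ₛ αₛ Xˢ = 0`. The numerator of `dλ` is a polynomial of degree
`k + m` with leading coefficient `k`, and by hypothesis it has `k + m` simple roots `c`. Each residue
in `<,>` and `<∘,>` is then a value at some `c` divided by `λ''(c)`.

Everything rests on the pairing `⟪f⟫ = ∑_c (λ / λ'')(c) f(c)`. Lagrange interpolation at the critical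
points gives `⟪xₛ xₜ⟫ = 1 / k` for `s ≠ t`, with `xₛ = 1 / (p - zˢ)`. The equation `dλ = 0` reads
`∑ₛ αₛ xₛ = 0`, and it replaces every residue computation at a double pole:
* `⟪xₛ A_X⟫ = -Xˢ` (`sum_weight_mul_inv_mul_polarSum`), so `X ↦ (∂_Xλ(c))_c` is an isomorphism
  onto functions on the critical set. It turns `∘` into the pointwise product
  (`InHurwitz.dSuper_circ`), `E` into `λ(c)` and hence `E⁻¹` into `1 / λ(c)`; nondegeneracy of `<,>`
  and existence and uniqueness of `E⁻¹` follow.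
* `(X, Y) = -⟪A_X A_Y⟫ = ∑ₛ αₛ Xˢ Yˢ`, a constant nondegenerate form.
* `(X ⋆ Y, Z) = ⟪A_X A_Y A_Z⟫ = ∑_{s<t} αₛ αₜ (Xˢ - Xᵗ)(Yˢ - Yᵗ)(Zˢ - Zᵗ) / (zˢ - zᵗ)`
  (`sum_weight_mul_polarSum_mul_polarSum_mul_polarSum`).

The last expression is the third derivative of `dualF`, because the third derivative of
`x² log x²` is `4 / x`. Two dual prepotentials have the same third derivatives, as these are
determined by `<,>`, `∘` and the unique `E⁻¹`; on a connected open set their difference is therefore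
a polynomial of degree at most two.
-/

namespace HurwitzDual

/-! ### Sums over the roots of a polynomial and over critical points -/

section SimpleRoots

open Polynomial

variable {R : ℂ[X]}

theorem nodup_roots_of_simple (hsimple : ∀ c, R.eval c = 0 → (derivative R).eval c ≠ 0) :
    R.roots.Nodup := by
  have hR0 : R ≠ 0 := by
    rintro rfl
    simpa using hsimple 0
  rw [Multiset.nodup_iff_count_le_one]
  intro c
  rw [count_roots]
  by_contra! h
  obtain ⟨h0, h1⟩ := (one_lt_rootMultiplicity_iff_isRoot hR0).1 h
  exact hsimple c h0 h1

theorem card_toFinset_roots (hsimple : ∀ c, R.eval c = 0 → (derivative R).eval c ≠ 0) :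
    R.roots.toFinset.card = R.natDegree := by
  rw [Multiset.toFinset_card_of_nodup (nodup_roots_of_simple hsimple),
    splits_iff_card_roots.1 (IsAlgClosed.splits R)]

/-- The residue theorem for `f / R` with `R` having simple roots and `deg f < deg R`, obtained
from Lagrange interpolation of `f` at the roots of `R`. -/
theorem sum_roots_eval_div_derivative {f : ℂ[X]} {n : ℕ} (hR : R.natDegree = n)
    (hsimple : ∀ c, R.eval c = 0 → (derivative R).eval c ≠ 0) (hf : f.degree < n) :
    ∑ c ∈ R.roots.toFinset, f.eval c / (derivative R).eval c =
      f.coeff (n - 1) / R.leadingCoeff := by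
  have hcard : R.roots.toFinset.card = n := by rw [card_toFinset_roots hsimple, hR]
  have hprod : R = C R.leadingCoeff * Lagrange.nodal R.roots.toFinset id := by
    conv_lhs => rw [(IsAlgClosed.splits R).eq_prod_roots]
    rw [Lagrange.nodal_eq]
    congr 1
    rw [Finset.prod_eq_multiset_prod, Multiset.toFinset_val, (nodup_roots_of_simple hsimple).dedup]
    rfl
  have key := Lagrange.coeff_eq_sum (s := R.roots.toFinset) (v := id)
    Function.injective_id.injOn (P := f) (by rwa [hcard])
  rw [hcard] at key
  rw [key, Finset.sum_div]
  refine Finset.sum_congr rfl fun c hc => ?_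
  have : (derivative R).eval c =
      R.leadingCoeff * ∏ j ∈ R.roots.toFinset.erase c, (c - j) := by
    conv_lhs => rw [hprod]
    rw [derivative_C_mul, eval_mul, eval_C]
    have := Lagrange.eval_nodal_derivative_eval_node_eq (v := id) hc
    rw [id] at this
    rw [this, Lagrange.eval_nodal]
    rfl
  rw [this, div_div, mul_comm]
  simp

end SimpleRoots

/-- The function `∑ₛ αₛ dₛ / (p - aₛ)`: minus the derivative of `log ∏ₛ (p - aₛ) ^ αₛ` when the
points `a` move with velocity `d`. -/
noncomputable def polarSum {ι : Type*} [Fintype ι] (a α d : ι → ℂ) (p : ℂ) : ℂ :=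
  ∑ s, α s * d s / (p - a s)

section Pairing

variable {ι : Type*} [Fintype ι] {a α : ι → ℂ} {C : Finset ℂ} {w : ℂ → ℂ} {κ : ℂ}

/-- On `C` the sum `∑ₜ αₜ / (c - aₜ)` vanishes, so `d` may be replaced by `d - d s`, which kills
the term with a double pole at `a s`. -/
theorem sum_weight_mul_inv_mul_polarSum (hκ : κ ≠ 0) (hα : ∑ s, α s = κ)
    (hcrit : ∀ c ∈ C, polarSum a α 1 c = 0)
    (hw : ∀ s t, s ≠ t → ∑ c ∈ C, w c * ((c - a s)⁻¹ * (c - a t)⁻¹) = κ⁻¹)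
    {d : ι → ℂ} (hd : ∑ s, α s * d s = 0) (s : ι) :
    ∑ c ∈ C, w c * ((c - a s)⁻¹ * polarSum a α d c) = -d s := by
  -- The factor `d t - d s` makes the sum over `C` at `t = s` irrelevant.
  have h1 : ∀ c ∈ C, w c * ((c - a s)⁻¹ * polarSum a α d c) =
      ∑ t, α t * (d t - d s) * (w c * ((c - a s)⁻¹ * (c - a t)⁻¹)) := by
    intro c hc
    have : polarSum a α d c = polarSum a α d c - d s * polarSum a α 1 c := by
      rw [hcrit c hc]; ring
    rw [this]
    simp only [polarSum, Finset.mul_sum, ← Finset.sum_sub_distrib, Pi.one_apply]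
    exact Finset.sum_congr rfl fun t _ => by ring
  rw [Finset.sum_congr rfl h1, Finset.sum_comm]
  have h2 : ∀ t, ∑ c ∈ C, α t * (d t - d s) * (w c * ((c - a s)⁻¹ * (c - a t)⁻¹)) =
      (α t * d t - α t * d s) * κ⁻¹ := by
    intro t
    rw [← Finset.mul_sum]
    by_cases hst : s = t
    · subst hst; ring
    · rw [hw s t hst]; ring
  rw [Finset.sum_congr rfl fun t _ => h2 t, ← Finset.sum_mul, Finset.sum_sub_distrib, hd,
    ← Finset.sum_mul, hα]
  field_simp
  ring

theorem sum_weight_mul_polarSum_mul_polarSum (hκ : κ ≠ 0) (hα : ∑ s, α s = κ)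
    (hcrit : ∀ c ∈ C, polarSum a α 1 c = 0)
    (hw : ∀ s t, s ≠ t → ∑ c ∈ C, w c * ((c - a s)⁻¹ * (c - a t)⁻¹) = κ⁻¹)
    (d : ι → ℂ) {e : ι → ℂ} (he : ∑ s, α s * e s = 0) :
    ∑ c ∈ C, w c * (polarSum a α d c * polarSum a α e c) = -∑ s, α s * d s * e s := by
  have h1 : ∀ c, w c * (polarSum a α d c * polarSum a α e c) =
      ∑ s, α s * d s * (w c * ((c - a s)⁻¹ * polarSum a α e c)) := by
    intro c
    rw [polarSum, Finset.sum_mul, Finset.mul_sum]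
    exact Finset.sum_congr rfl fun t _ => by ring
  rw [Finset.sum_congr rfl fun c _ => h1 c, Finset.sum_comm, ← Finset.sum_neg_distrib]
  refine Finset.sum_congr rfl fun s _ => ?_
  rw [← Finset.mul_sum, sum_weight_mul_inv_mul_polarSum hκ hα hcrit hw he]
  ring

/-- The sum over all ordered pairs `(s, t)`; the diagonal terms have numerator
zero. On `C` one has
`-2 A_d A_e = ∑ₛₜ αₛ αₜ (dₛ - dₜ) (eₛ - eₜ) xₛ xₜ` with `xₛ = (c - aₛ)⁻¹`, and the identity
`(aₛ - aₜ) xₛ xₜ = xₛ - xₜ` reduces the triple product to `sum_weight_mul_inv_mul_polarSum`. -/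
theorem sum_weight_mul_polarSum_mul_polarSum_mul_polarSum (hκ : κ ≠ 0) (hα : ∑ s, α s = κ)
    (hcrit : ∀ c ∈ C, polarSum a α 1 c = 0)
    (hw : ∀ s t, s ≠ t → ∑ c ∈ C, w c * ((c - a s)⁻¹ * (c - a t)⁻¹) = κ⁻¹)
    (ha : Function.Injective a) (hC : ∀ c ∈ C, ∀ s, c ≠ a s)
    (d e : ι → ℂ) {f : ι → ℂ} (hf : ∑ s, α s * f s = 0) :
    ∑ c ∈ C, w c * (polarSum a α d c * polarSum a α e c * polarSum a α f c) =
      (1 / 2) * ∑ s, ∑ t, α s * α t * (d s - d t) * (e s - e t) * (f s - f t) / (a s - a t) := by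
  have h0 : ∀ c ∈ C, polarSum a α d c * polarSum a α e c =
      -(1 / 2) * ∑ s, ∑ t, α s * α t * (d s - d t) * (e s - e t) *
        ((c - a s)⁻¹ * (c - a t)⁻¹) := by
    intro c hc
    have expand : ∑ s, ∑ t, α s * α t * (d s - d t) * (e s - e t) *
        ((c - a s)⁻¹ * (c - a t)⁻¹) =
        2 * (polarSum a α (d * e) c * polarSum a α 1 c) -
          2 * (polarSum a α d c * polarSum a α e c) := by
      have hA : polarSum a α (d * e) c * polarSum a α 1 c =
          ∑ s, ∑ t, α s * α t * (d s * e s) * ((c - a s)⁻¹ * (c - a t)⁻¹) := by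
        simp only [polarSum, Finset.sum_mul_sum, Pi.mul_apply, Pi.one_apply]
        exact Finset.sum_congr rfl fun s _ => Finset.sum_congr rfl fun t _ => by ring
      have hA' : polarSum a α (d * e) c * polarSum a α 1 c =
          ∑ s, ∑ t, α s * α t * (d t * e t) * ((c - a s)⁻¹ * (c - a t)⁻¹) := by
        rw [hA, Finset.sum_comm]
        exact Finset.sum_congr rfl fun s _ => Finset.sum_congr rfl fun t _ => by ring
      have hB : polarSum a α d c * polarSum a α e c =
          ∑ s, ∑ t, α s * α t * (d s * e t) * ((c - a s)⁻¹ * (c - a t)⁻¹) := by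
        simp only [polarSum, Finset.sum_mul_sum]
        exact Finset.sum_congr rfl fun s _ => Finset.sum_congr rfl fun t _ => by ring
      have hB' : polarSum a α d c * polarSum a α e c =
          ∑ s, ∑ t, α s * α t * (d t * e s) * ((c - a s)⁻¹ * (c - a t)⁻¹) := by
        rw [hB, Finset.sum_comm]
        exact Finset.sum_congr rfl fun s _ => Finset.sum_congr rfl fun t _ => by ring
      rw [two_mul, two_mul]
      nth_rewrite 1 [hA]
      rw [hA']
      nth_rewrite 1 [hB]
      rw [hB']
      simp only [← Finset.sum_add_distrib, ← Finset.sum_sub_distrib]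
      exact Finset.sum_congr rfl fun s _ => Finset.sum_congr rfl fun t _ => by ring
    rw [expand, hcrit c hc]
    ring
  have h1 : ∀ c ∈ C, w c * (polarSum a α d c * polarSum a α e c * polarSum a α f c) =
      ∑ s, ∑ t, -(1 / 2) * (α s * α t * (d s - d t) * (e s - e t) / (a s - a t)) *
        (w c * ((c - a s)⁻¹ * polarSum a α f c) - w c * ((c - a t)⁻¹ * polarSum a α f c)) := by
    intro c hc
    rw [h0 c hc]
    simp only [Finset.mul_sum, Finset.sum_mul]
    refine Finset.sum_congr rfl fun s _ => Finset.sum_congr rfl fun t _ => ?_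
    by_cases hst : s = t
    · subst hst; ring
    have h2 : a s - a t ≠ 0 := sub_ne_zero.2 (ha.ne hst)
    have h3 : c - a s ≠ 0 := sub_ne_zero.2 (hC c hc s)
    have h4 : c - a t ≠ 0 := sub_ne_zero.2 (hC c hc t)
    field_simp
    ring
  rw [Finset.sum_congr rfl h1, Finset.sum_comm, Finset.mul_sum]
  refine Finset.sum_congr rfl fun s _ => ?_
  rw [Finset.sum_comm, Finset.mul_sum]
  refine Finset.sum_congr rfl fun t _ => ?_
  rw [← Finset.mul_sum, Finset.sum_sub_distrib,
    sum_weight_mul_inv_mul_polarSum hκ hα hcrit hw hf,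
    sum_weight_mul_inv_mul_polarSum hκ hα hcrit hw hf]
  ring

end Pairing

/-! ### Residues at simple poles -/

/-- A simple pole: the residue of `g / f` at a simple zero of `f`. -/
theorem residue_div_of_simple_zero {g f : ℂ → ℂ} {c : ℂ} (hg : AnalyticAt ℂ g c)
    (hf : AnalyticAt ℂ f c) (hf0 : f c = 0) (hf1 : deriv f c ≠ 0) :
    residue (fun p => g p / f p) c = g c / deriv f c := by
  have hds : AnalyticAt ℂ (dslope f c) c := by
    obtain ⟨p, hp⟩ := hf
    exact ⟨_, hp.has_fpower_series_dslope_fslope⟩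
  have hds0 : dslope f c c ≠ 0 := by rwa [dslope_same]
  have hh : AnalyticAt ℂ (fun p => g p / dslope f c p) c := hg.div hds hds0
  obtain ⟨ε, hε, hball⟩ := Metric.eventually_nhds_iff_ball.1 hh.eventually_analyticAt
  refine Filter.Tendsto.limUnder_eq (tendsto_const_nhds.congr' ?_)
  filter_upwards [Ioo_mem_nhdsGT hε] with r hr
  have hd : DifferentiableOn ℂ (fun p => g p / dslope f c p) (Metric.closedBall c r) :=
    fun p hp => (hball p (Metric.closedBall_subset_ball hr.2 hp)).differentiableAt
      |>.differentiableWithinAt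
  have hint := hd.circleIntegral_sub_inv_smul (Metric.mem_ball_self hr.1)
  have hcongr : (∮ p in C(c, r), g p / f p) =
      ∮ p in C(c, r), (p - c)⁻¹ • (g p / dslope f c p) := by
    refine circleIntegral.integral_congr hr.1.le fun p hp => ?_
    have hpc : p ≠ c := by
      rintro rfl
      simp at hp
      exact hr.1.ne hp
    have h1 : p - c ≠ 0 := sub_ne_zero.2 hpc
    have h2 : f p = (p - c) * dslope f c p := by
      have := sub_smul_dslope f c p
      rw [hf0, sub_zero, smul_eq_mul] at this
      exact this.symm
    simp only [smul_eq_mul]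
    rw [h2, div_mul_eq_div_div_swap, div_eq_inv_mul (g p / _)]
  have hpi : (2 * (Real.pi : ℂ) * Complex.I) ≠ 0 := Complex.two_pi_I_ne_zero
  rw [hcongr, hint, smul_eq_mul, dslope_same, ← mul_assoc, inv_mul_cancel₀ hpi, one_mul]

/-! ### The superpotential and its critical points -/

section Superpotential

open Polynomial

variable {k m : ℕ} {z : Pt k m}

theorem pole_add_smul (z X : Pt k m) (t : ℂ) :
    pole k m (z + t • X) = pole k m z + t * pole k m X := by
  simp only [pole, Pi.add_apply, Pi.smul_apply, smul_eq_mul, Finset.sum_add_distrib,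
    ← Finset.mul_sum]
  ring

@[simp] theorem points_zero (z : Pt k m) : points k m z 0 = pole k m z := rfl

@[simp] theorem points_succ (z : Pt k m) (i : Fin (k + m)) : points k m z i.succ = z i := rfl

@[simp] theorem weight_zero : weight k m 0 = -(m : ℂ) := rfl

@[simp] theorem weight_succ (i : Fin (k + m)) : weight k m i.succ = 1 := rfl

theorem sum_weight : ∑ s, weight k m s = k := by
  simp [Fin.sum_univ_succ]

theorem sum_weight_mul_points (hm : 0 < m) (X : Pt k m) :
    ∑ s, weight k m s * points k m X s = 0 := by
  have : (m : ℂ) ≠ 0 := by exact_mod_cast hm.ne'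
  simp only [Fin.sum_univ_succ, weight_zero, points_zero, weight_succ, points_succ, pole, one_mul]
  field_simp
  ring

namespace InHurwitz

theorem points_injective (h : InHurwitz k m z) : Function.Injective (points k m z) := by
  rw [points, Fin.cons_injective_iff]
  refine ⟨?_, h.zeros_distinct⟩
  rintro ⟨i, hi⟩
  exact h.pole_ne i hi

end InHurwitz

/-- The monic polynomial `∏ (p - z^i)` whose roots are the zeros of `λ`. -/
noncomputable def zeroPoly (k m : ℕ) (z : Pt k m) : ℂ[X] := Lagrange.nodal Finset.univ z

/-- The numerator of `dλ`: one has `λ' = critPoly / (p - z^0) ^ (m + 1)`. -/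
noncomputable def critPoly (k m : ℕ) (z : Pt k m) : ℂ[X] :=
  derivative (zeroPoly k m z) * (X - C (pole k m z)) - C (m : ℂ) * zeroPoly k m z

theorem superpot_eq (z : Pt k m) (p : ℂ) :
    superpot k m z p = (zeroPoly k m z).eval p / (p - pole k m z) ^ m := by
  rw [superpot, zeroPoly, Lagrange.eval_nodal]

theorem hasDerivAt_superpot (hm : 0 < m) {p : ℂ} (hp : p ≠ pole k m z) :
    HasDerivAt (superpot k m z) ((critPoly k m z).eval p / (p - pole k m z) ^ (m + 1)) p := by
  have h0 : p - pole k m z ≠ 0 := sub_ne_zero.2 hp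
  have h := ((zeroPoly k m z).hasDerivAt p).fun_div
    (((hasDerivAt_id' p).sub_const (pole k m z)).fun_pow m) (pow_ne_zero m h0)
  have hfun : superpot k m z =
      fun p => (zeroPoly k m z).eval p / (p - pole k m z) ^ m := funext (superpot_eq z)
  rw [hfun]
  refine h.congr_deriv ?_
  obtain ⟨n, rfl⟩ : ∃ n, m = n + 1 := ⟨m - 1, by omega⟩
  simp only [critPoly, eval_sub, eval_mul, eval_X, eval_C, Nat.add_sub_cancel]
  field_simp
  push_cast
  ring

theorem deriv_superpot_eventuallyEq (hm : 0 < m) {c : ℂ} (hc : c ≠ pole k m z) :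
    deriv (superpot k m z) =ᶠ[𝓝 c]
      fun p => (critPoly k m z).eval p / (p - pole k m z) ^ (m + 1) := by
  filter_upwards [isOpen_ne.mem_nhds hc] with p hp
  exact (hasDerivAt_superpot hm hp).deriv

theorem deriv_deriv_superpot (hm : 0 < m) {c : ℂ} (hc : c ≠ pole k m z)
    (h0 : (critPoly k m z).eval c = 0) :
    deriv (deriv (superpot k m z)) c =
      (derivative (critPoly k m z)).eval c / (c - pole k m z) ^ (m + 1) := by
  rw [(deriv_superpot_eventuallyEq hm hc).deriv_eq]
  have hne : c - pole k m z ≠ 0 := sub_ne_zero.2 hc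
  have h := ((critPoly k m z).hasDerivAt c).fun_div
    (((hasDerivAt_id' c).sub_const (pole k m z)).fun_pow (m + 1)) (pow_ne_zero _ hne)
  rw [h.deriv, h0]
  field_simp
  ring

theorem eval_zeroPoly_ne_zero {p : ℂ} (hp : ∀ i, p ≠ z i) : (zeroPoly k m z).eval p ≠ 0 :=
  Lagrange.eval_nodal_not_at_node fun i _ => hp i

/-- `critPoly` is the numerator of the logarithmic derivative of `λ`. -/
theorem eval_critPoly {p : ℂ} (hp : ∀ s, p ≠ points k m z s) :
    (critPoly k m z).eval p = (p - pole k m z) * (zeroPoly k m z).eval p *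
      polarSum (points k m z) (weight k m) 1 p := by
  have h0 : p - pole k m z ≠ 0 := sub_ne_zero.2 (hp 0)
  have hder : (derivative (zeroPoly k m z)).eval p =
      ∑ i, (zeroPoly k m z).eval p * (p - z i)⁻¹ := by
    rw [zeroPoly, Lagrange.derivative_nodal, eval_finsetSum]
    refine Finset.sum_congr rfl fun i hi => ?_
    have hi' : p - z i ≠ 0 := sub_ne_zero.2 (hp i.succ)
    rw [Lagrange.nodal_eq_mul_nodal_erase hi, eval_mul]
    simp only [eval_sub, eval_X, eval_C]
    field_simp
  simp only [critPoly, polarSum, Fin.sum_univ_succ, eval_sub, eval_mul, eval_X, eval_C, hder,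
    points_zero, points_succ, weight_zero, weight_succ, Pi.one_apply, ← Finset.mul_sum,
    mul_one, one_div]
  field_simp
  ring

theorem natDegree_zeroPoly (z : Pt k m) : (zeroPoly k m z).natDegree = k + m := by
  simp [zeroPoly, Lagrange.natDegree_nodal]

theorem coeff_critPoly (hm : 0 < m) (z : Pt k m) : (critPoly k m z).coeff (k + m) = k := by
  have h1 : (zeroPoly k m z).coeff (k + m) = 1 := by
    have : (zeroPoly k m z).Monic := Lagrange.nodal_monic
    rw [← natDegree_zeroPoly z]
    exact this
  have h2 : (zeroPoly k m z).coeff (k + m + 1) = 0 :=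
    coeff_eq_zero_of_natDegree_lt (by rw [natDegree_zeroPoly]; omega)
  obtain ⟨n, hn⟩ : ∃ n, k + m = n + 1 := ⟨k + m - 1, by omega⟩
  rw [critPoly, mul_sub, coeff_sub, coeff_sub, coeff_mul_C, coeff_C_mul, hn, coeff_mul_X,
    coeff_derivative, coeff_derivative, ← hn, h1, h2]
  have : (n : ℂ) + 1 = k + m := by exact_mod_cast hn.symm
  rw [this]
  ring

theorem natDegree_critPoly (hk : 0 < k) (hm : 0 < m) (z : Pt k m) :
    (critPoly k m z).natDegree = k + m := by
  refine natDegree_eq_of_le_of_coeff_ne_zero ?_ ?_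
  · refine (natDegree_sub_le _ _).trans (max_le ?_ ?_)
    · refine natDegree_mul_le.trans ?_
      have := natDegree_derivative_le (zeroPoly k m z)
      rw [natDegree_zeroPoly] at this
      rw [natDegree_X_sub_C]
      omega
    · exact (natDegree_C_mul_le _ _).trans (natDegree_zeroPoly z).le
  · rw [coeff_critPoly hm]
    exact_mod_cast hk.ne'

theorem leadingCoeff_critPoly (hk : 0 < k) (hm : 0 < m) (z : Pt k m) :
    (critPoly k m z).leadingCoeff = k := by
  rw [leadingCoeff, natDegree_critPoly hk hm, coeff_critPoly hm]

/-- The zeros of `dλ`, as a finite set. -/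
noncomputable def critFinset (k m : ℕ) (z : Pt k m) : Finset ℂ := (critPoly k m z).roots.toFinset

theorem mem_critFinset (hk : 0 < k) (hm : 0 < m) {c : ℂ} :
    c ∈ critFinset k m z ↔ (critPoly k m z).eval c = 0 := by
  have : critPoly k m z ≠ 0 := by
    intro h
    have := natDegree_critPoly hk hm z
    rw [h, natDegree_zero] at this
    omega
  rw [critFinset, Multiset.mem_toFinset, mem_roots this, IsRoot.def]

/-- `λ / λ''` at a critical point. -/
noncomputable def critWeight (k m : ℕ) (z : Pt k m) (c : ℂ) : ℂ :=
  superpot k m z c / deriv (deriv (superpot k m z)) c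

namespace InHurwitz

/-- The zeros of `dλ` avoid `z^0`, where `critPoly` equals `-m ∏ (z^0 - z^i)`, and the zeros of
`λ`, which are simple. -/
theorem ne_points (h : InHurwitz k m z) (hk : 0 < k) (hm : 0 < m) {c : ℂ}
    (hc : c ∈ critFinset k m z) (s : Fin (k + m + 1)) : c ≠ points k m z s := by
  rw [mem_critFinset hk hm] at hc
  rintro rfl
  induction s using Fin.cases with
  | zero =>
    simp only [points_zero, critPoly, eval_sub, eval_mul, eval_X, eval_C, sub_self, mul_zero,
      zero_sub, neg_eq_zero, mul_eq_zero, Nat.cast_eq_zero] at hc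
    exact hc.elim hm.ne' (eval_zeroPoly_ne_zero fun i => (h.pole_ne i).symm)
  | succ i =>
    have h1 : (zeroPoly k m z).eval (z i) = 0 := Lagrange.eval_nodal_at_node (Finset.mem_univ i)
    simp only [points_succ, critPoly, eval_sub, eval_mul, eval_X, eval_C, h1, mul_zero,
      sub_zero, mul_eq_zero, sub_eq_zero] at hc
    refine hc.elim (fun h2 => ?_) (h.pole_ne i)
    rw [zeroPoly, Lagrange.eval_nodal_derivative_eval_node_eq (Finset.mem_univ i)] at h2
    refine Lagrange.eval_nodal_not_at_node (fun j hj => ?_) h2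
    exact h.zeros_distinct.ne (Finset.ne_of_mem_erase hj).symm

theorem superpot_ne_zero (h : InHurwitz k m z) (hk : 0 < k) (hm : 0 < m) {c : ℂ}
    (hc : c ∈ critFinset k m z) : superpot k m z c ≠ 0 := by
  rw [superpot_eq]
  exact div_ne_zero (eval_zeroPoly_ne_zero fun i => h.ne_points hk hm hc i.succ)
    (pow_ne_zero _ (sub_ne_zero.2 (h.ne_points hk hm hc 0)))

theorem coe_critFinset (h : InHurwitz k m z) (hk : 0 < k) (hm : 0 < m) :
    (critFinset k m z : Set ℂ) = critPts k m z := by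
  ext c
  rw [Finset.mem_coe]
  refine ⟨fun hc => ?_, fun ⟨hc, hd⟩ => ?_⟩
  · have h0 := h.ne_points hk hm hc 0
    rw [points_zero] at h0
    refine ⟨h0, ?_⟩
    rw [(hasDerivAt_superpot hm h0).deriv, (mem_critFinset hk hm).1 hc, zero_div]
  · rw [(hasDerivAt_superpot hm hc).deriv] at hd
    rw [mem_critFinset hk hm]
    exact (div_eq_zero_iff.1 hd).resolve_right (pow_ne_zero _ (sub_ne_zero.2 hc))

theorem deriv_deriv_superpot_ne_zero (h : InHurwitz k m z) (hk : 0 < k) (hm : 0 < m) {c : ℂ}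
    (hc : c ∈ critFinset k m z) : deriv (deriv (superpot k m z)) c ≠ 0 := by
  refine h.simple c ?_
  rw [← h.coe_critFinset hk hm]
  exact hc

theorem eval_derivative_critPoly_ne_zero (h : InHurwitz k m z) (hk : 0 < k) (hm : 0 < m) {c : ℂ}
    (hc : (critPoly k m z).eval c = 0) : (derivative (critPoly k m z)).eval c ≠ 0 := by
  have hc' := (mem_critFinset hk hm).2 hc
  have := h.deriv_deriv_superpot_ne_zero hk hm hc'
  rw [deriv_deriv_superpot hm (h.ne_points hk hm hc' 0) hc] at this
  exact fun h0 => this (by rw [h0, zero_div])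

theorem card_critFinset (h : InHurwitz k m z) (hk : 0 < k) (hm : 0 < m) :
    (critFinset k m z).card = k + m := by
  rw [critFinset, card_toFinset_roots (fun c hc => h.eval_derivative_critPoly_ne_zero hk hm hc),
    natDegree_critPoly hk hm]

theorem polarSum_one_eq_zero (h : InHurwitz k m z) (hk : 0 < k) (hm : 0 < m) {c : ℂ}
    (hc : c ∈ critFinset k m z) : polarSum (points k m z) (weight k m) 1 c = 0 := by
  have h1 := eval_critPoly (h.ne_points hk hm hc)
  rw [(mem_critFinset hk hm).1 hc, eq_comm, mul_eq_zero, mul_eq_zero] at h1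
  refine h1.resolve_left (not_or.2 ⟨sub_ne_zero.2 (h.ne_points hk hm hc 0), ?_⟩)
  exact eval_zeroPoly_ne_zero fun i => h.ne_points hk hm hc i.succ

theorem critWeight_eq (h : InHurwitz k m z) (hk : 0 < k) (hm : 0 < m) {c : ℂ}
    (hc : c ∈ critFinset k m z) :
    critWeight k m z c = (Lagrange.nodal Finset.univ (points k m z)).eval c /
      (derivative (critPoly k m z)).eval c := by
  have h0 := h.ne_points hk hm hc 0
  rw [points_zero] at h0
  have hc0 := (mem_critFinset hk hm).1 hc
  have h1 := h.eval_derivative_critPoly_ne_zero hk hm hc0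
  have h2 : c - pole k m z ≠ 0 := sub_ne_zero.2 h0
  rw [critWeight, superpot_eq, deriv_deriv_superpot hm h0 hc0, Lagrange.eval_nodal,
    Fin.prod_univ_succ, zeroPoly, Lagrange.eval_nodal]
  simp only [points_zero, points_succ]
  field_simp
  ring

/-- The polynomial `∏ᵤ (p - zᵘ) / ((p - zˢ) (p - zᵗ))` is monic of degree one less than the
number of critical points. -/
theorem sum_critWeight_mul_inv_mul_inv (h : InHurwitz k m z) (hk : 0 < k) (hm : 0 < m)
    {s t : Fin (k + m + 1)} (hst : s ≠ t) :
    ∑ c ∈ critFinset k m z,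
      critWeight k m z c * ((c - points k m z s)⁻¹ * (c - points k m z t)⁻¹) = (k : ℂ)⁻¹ := by
  have hts : t ∈ Finset.univ.erase s := Finset.mem_erase.2 ⟨hst.symm, Finset.mem_univ t⟩
  set f : ℂ[X] := Lagrange.nodal ((Finset.univ.erase s).erase t) (points k m z) with hf
  have hcard : ((Finset.univ.erase s).erase t).card = k + m - 1 := by
    rw [Finset.card_erase_of_mem hts, Finset.card_erase_of_mem (Finset.mem_univ s),
      Finset.card_univ, Fintype.card_fin]
    omega
  have hdeg : f.natDegree = k + m - 1 := by rw [hf, Lagrange.natDegree_nodal, hcard]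
  have hmonic : f.Monic := Lagrange.nodal_monic
  have hdeg' : f.degree < (k + m : ℕ) := by
    rw [degree_eq_natDegree hmonic.ne_zero, hdeg]
    exact_mod_cast (by omega : k + m - 1 < k + m)
  have key := sum_roots_eval_div_derivative (natDegree_critPoly hk hm z)
    (fun c hc => h.eval_derivative_critPoly_ne_zero hk hm hc) hdeg'
  have hlead : f.coeff (k + m - 1) = 1 := by
    rw [← hdeg]
    exact hmonic
  rw [hlead, leadingCoeff_critPoly hk hm, one_div] at key
  rw [← key]
  refine Finset.sum_congr rfl fun c hc => ?_
  have h1 : c - points k m z s ≠ 0 := sub_ne_zero.2 (h.ne_points hk hm hc s)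
  have h2 : c - points k m z t ≠ 0 := sub_ne_zero.2 (h.ne_points hk hm hc t)
  rw [h.critWeight_eq hk hm hc, Lagrange.nodal_eq_mul_nodal_erase (Finset.mem_univ s),
    Lagrange.nodal_eq_mul_nodal_erase hts, eval_mul, eval_mul]
  simp only [eval_sub, eval_X, eval_C, ← hf]
  field_simp

end InHurwitz

/-- The logarithmic derivative of `λ = ∏ₛ (p - zˢ) ^ αₛ` along `X`. -/
theorem dSuper_eq (X : Pt k m) {p : ℂ} (hp : ∀ s, p ≠ points k m z s) :
    dSuper k m z X p =
      -(superpot k m z p * polarSum (points k m z) (weight k m) (points k m X) p) := by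
  have h0 : p - pole k m z ≠ 0 := sub_ne_zero.2 (hp 0)
  have hdiff : DifferentiableAt ℂ (fun w : Pt k m => superpot k m w p) z := by
    have hden : (p - (∑ i, z i) / (m : ℂ)) ^ m ≠ 0 := pow_ne_zero _ h0
    unfold superpot pole
    fun_prop (disch := exact hden)
  rw [dSuper, ← hdiff.lineDeriv_eq_fderiv, lineDeriv]
  have hnum : HasDerivAt (fun t : ℂ => ∏ i, (p - (z + t • X) i))
      (∑ i, (∏ j ∈ Finset.univ.erase i, (p - (z + (0 : ℂ) • X) j)) • (-X i)) 0 := by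
    refine HasDerivAt.fun_finsetProd fun i _ => ?_
    have := (((hasDerivAt_id' (0 : ℂ)).mul_const (X i)).const_add (z i)).const_sub p
    simpa using this
  have hden : HasDerivAt (fun t : ℂ => p - pole k m (z + t • X)) (-pole k m X) 0 := by
    have := (((hasDerivAt_id' (0 : ℂ)).mul_const (pole k m X)).const_add (pole k m z)).const_sub p
    simpa [pole_add_smul] using this
  have hden0 : p - pole k m (z + (0 : ℂ) • X) ≠ 0 := by simpa using h0
  have hquot := hnum.fun_div (hden.fun_pow m) (pow_ne_zero m hden0)
  have hfun : (fun t : ℂ => superpot k m (z + t • X) p) =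
      fun t : ℂ => (∏ i, (p - (z + t • X) i)) / (p - pole k m (z + t • X)) ^ m := rfl
  rw [hfun, hquot.deriv]
  have hprod : ∀ i, ∏ j ∈ Finset.univ.erase i, (p - z j) = (∏ j, (p - z j)) / (p - z i) := by
    intro i
    rw [← Finset.mul_prod_erase _ _ (Finset.mem_univ i),
      mul_div_cancel_left₀ _ (sub_ne_zero.2 (show p ≠ z i from hp i.succ))]
  simp only [zero_smul, add_zero, hprod, polarSum, Fin.sum_univ_succ, points_zero, points_succ,
    weight_zero, weight_succ, superpot, smul_eq_mul, one_mul]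
  have hsum : ∑ i, (∏ j, (p - z j)) / (p - z i) * -X i =
      -((∏ j, (p - z j)) * ∑ i, X i / (p - z i)) := by
    rw [Finset.mul_sum, ← Finset.sum_neg_distrib]
    exact Finset.sum_congr rfl fun i _ => by ring
  rw [hsum]
  -- `m = 0` is separated because the derivative of the power contains the exponent `m - 1`.
  rcases m with _ | n
  · simp
  · simp only [Nat.add_sub_cancel]
    field_simp
    ring

end Superpotential

/-! ### Multiplication, Euler field and intersection form -/

section FrobeniusStructure

variable {k m : ℕ} {z : Pt k m}

theorem clm_apply_eq_sum (f : Pt k m →L[ℂ] ℂ) (X : Pt k m) :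
    f X = ∑ j, f (basisVec k m j) * X j := by
  have := LinearMap.pi_apply_eq_sum_univ (f : Pt k m →ₗ[ℂ] ℂ) X
  simp only [ContinuousLinearMap.coe_coe, smul_eq_mul] at this
  rw [this]
  refine Finset.sum_congr rfl fun j _ => ?_
  rw [mul_comm]
  congr 2
  ext i
  simp [basisVec, Pi.single_apply, eq_comm]

theorem dSuper_eq_sum (X : Pt k m) (p : ℂ) :
    dSuper k m z X p = ∑ j, dSuper k m z (basisVec k m j) p * X j :=
  clm_apply_eq_sum _ X

theorem points_div (z : Pt k m) (a : ℂ) (s : Fin (k + m + 1)) :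
    points k m (fun i => z i / a) s = points k m z s / a := by
  refine Fin.cases ?_ (fun i => rfl) s
  simp only [points_zero, pole, ← Finset.sum_div]
  ring

theorem analyticAt_superpot (hm : 0 < m) {c : ℂ} (hc : c ≠ pole k m z) :
    AnalyticAt ℂ (superpot k m z) c := by
  rw [Complex.analyticAt_iff_eventually_differentiableAt]
  filter_upwards [isOpen_ne.mem_nhds hc] with p hp
  exact (hasDerivAt_superpot hm hp).differentiableAt

theorem analyticAt_dSuper (hm : 0 < m) (X : Pt k m) {c : ℂ} (hc : ∀ s, c ≠ points k m z s) :
    AnalyticAt ℂ (dSuper k m z X) c := by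
  have hev : dSuper k m z X =ᶠ[𝓝 c] fun p =>
      -(superpot k m z p * polarSum (points k m z) (weight k m) (points k m X) p) := by
    filter_upwards [Filter.eventually_all.2 fun s => isOpen_ne.mem_nhds (hc s)] with p hp
    exact dSuper_eq X hp
  refine AnalyticAt.congr ?_ hev.symm
  refine ((analyticAt_superpot hm (hc 0)).mul ?_).neg
  unfold polarSum
  refine Finset.analyticAt_fun_sum _ fun s _ => ?_
  exact analyticAt_const.div (analyticAt_id.sub analyticAt_const) (sub_ne_zero.2 (hc s))

/-- The map `X ↦ (∂_Xλ(c))_c` from the tangent space to functions on the set of critical points.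
It identifies `∘` with the pointwise product. -/
noncomputable def critEval (k m : ℕ) (z : Pt k m) : Pt k m →ₗ[ℂ] (critFinset k m z → ℂ) where
  toFun X c := dSuper k m z X c
  map_add' X Y := by
    ext c
    simp [dSuper]
  map_smul' t X := by
    ext c
    simp [dSuper]

theorem critEval_apply (X : Pt k m) (c : critFinset k m z) :
    critEval k m z X c = dSuper k m z X c := rfl

namespace InHurwitz

theorem sum_inv_mul_polarSum (h : InHurwitz k m z) (hk : 0 < k) (hm : 0 < m) (X : Pt k m)
    (s : Fin (k + m + 1)) :
    ∑ c ∈ critFinset k m z, critWeight k m z c * ((c - points k m z s)⁻¹ *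
      polarSum (points k m z) (weight k m) (points k m X) c) = -points k m X s :=
  sum_weight_mul_inv_mul_polarSum (Nat.cast_ne_zero.2 hk.ne') sum_weight
    (fun _ hc => h.polarSum_one_eq_zero hk hm hc)
    (fun _ _ hst => h.sum_critWeight_mul_inv_mul_inv hk hm hst) (sum_weight_mul_points hm X) s

theorem dSuper_eq (h : InHurwitz k m z) (hk : 0 < k) (hm : 0 < m) (X : Pt k m) {c : ℂ}
    (hc : c ∈ critFinset k m z) : dSuper k m z X c =
      -(superpot k m z c * polarSum (points k m z) (weight k m) (points k m X) c) :=
  HurwitzDual.dSuper_eq X (h.ne_points hk hm hc)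

/-- If `∂_Xλ` vanishes at all critical points then so does `A_X`, and `⟪xₛ A_X⟫ = -Xˢ`. -/
theorem critEval_injective (h : InHurwitz k m z) (hk : 0 < k) (hm : 0 < m) :
    Function.Injective (critEval k m z) := by
  refine (injective_iff_map_eq_zero _).2 fun X hX => ?_
  have hzero : ∀ c ∈ critFinset k m z,
      polarSum (points k m z) (weight k m) (points k m X) c = 0 := by
    intro c hc
    have h1 := congrFun hX ⟨c, hc⟩
    rw [critEval_apply, h.dSuper_eq hk hm X hc] at h1
    simpa [h.superpot_ne_zero hk hm hc] using h1
  ext i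
  have h2 := h.sum_inv_mul_polarSum hk hm X i.succ
  rw [Finset.sum_eq_zero fun c hc => by rw [hzero c hc]; ring] at h2
  simpa using h2.symm

theorem critEval_surjective (h : InHurwitz k m z) (hk : 0 < k) (hm : 0 < m) :
    Function.Surjective (critEval k m z) := by
  refine (LinearMap.injective_iff_surjective_of_finrank_eq_finrank ?_).1
    (h.critEval_injective hk hm)
  simp [h.card_critFinset hk hm]

theorem exists_dSuper_eq (h : InHurwitz k m z) (hk : 0 < k) (hm : 0 < m) (g : ℂ → ℂ) :
    ∃ X : Pt k m, ∀ c ∈ critFinset k m z, dSuper k m z X c = g c := by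
  obtain ⟨X, hX⟩ := h.critEval_surjective hk hm fun c => g c
  exact ⟨X, fun c hc => congrFun hX ⟨c, hc⟩⟩

theorem ext_dSuper (h : InHurwitz k m z) (hk : 0 < k) (hm : 0 < m) {X Y : Pt k m}
    (hXY : ∀ c ∈ critFinset k m z, dSuper k m z X c = dSuper k m z Y c) : X = Y :=
  h.critEval_injective hk hm (funext fun c => hXY c c.2)

/-- The zeros of `dλ` are simple, so only simple poles contribute. -/
theorem critRes_div (h : InHurwitz k m z) (hk : 0 < k) (hm : 0 < m) {g : ℂ → ℂ}
    (hg : ∀ c ∈ critFinset k m z, AnalyticAt ℂ g c) :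
    critRes k m z (fun p => g p / deriv (superpot k m z) p) =
      ∑ c ∈ critFinset k m z, g c / deriv (deriv (superpot k m z)) c := by
  rw [critRes, ← h.coe_critFinset hk hm, finsum_mem_coe_finset]
  refine Finset.sum_congr rfl fun c hc => ?_
  have hcrit : c ∈ critPts k m z := by
    rw [← h.coe_critFinset hk hm]
    exact hc
  exact residue_div_of_simple_zero (hg c hc) (analyticAt_superpot hm hcrit.1).deriv hcrit.2
    (h.simple c hcrit)

theorem eta_eq (h : InHurwitz k m z) (hk : 0 < k) (hm : 0 < m) (X Y : Pt k m) :
    eta k m z X Y = -∑ c ∈ critFinset k m z,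
      dSuper k m z X c * dSuper k m z Y c / deriv (deriv (superpot k m z)) c := by
  have ha : ∀ W, ∀ c ∈ critFinset k m z, AnalyticAt ℂ (dSuper k m z W) c :=
    fun W c hc => analyticAt_dSuper hm W (h.ne_points hk hm hc)
  exact congrArg Neg.neg (h.critRes_div hk hm fun c hc => (ha X c hc).mul (ha Y c hc))

theorem triple_eq (h : InHurwitz k m z) (hk : 0 < k) (hm : 0 < m) (X Y Z : Pt k m) :
    triple k m z X Y Z = -∑ c ∈ critFinset k m z,
      dSuper k m z X c * dSuper k m z Y c * dSuper k m z Z c /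
        deriv (deriv (superpot k m z)) c := by
  have ha : ∀ W, ∀ c ∈ critFinset k m z, AnalyticAt ℂ (dSuper k m z W) c :=
    fun W c hc => analyticAt_dSuper hm W (h.ne_points hk hm hc)
  exact congrArg Neg.neg
    (h.critRes_div hk hm fun c hc => ((ha X c hc).mul (ha Y c hc)).mul (ha Z c hc))

theorem etaMatrix_mulVec (h : InHurwitz k m z) (hk : 0 < k) (hm : 0 < m) (W : Pt k m)
    (i : Fin (k + m)) :
    (etaMatrix k m z).mulVec W i = eta k m z (basisVec k m i) W := by
  simp only [Matrix.mulVec, dotProduct, etaMatrix, Matrix.of_apply, h.eta_eq hk hm, neg_mul,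
    Finset.sum_neg_distrib, Finset.sum_mul]
  rw [Finset.sum_comm]
  congr 1
  refine Finset.sum_congr rfl fun c _ => ?_
  rw [dSuper_eq_sum W, Finset.mul_sum, Finset.sum_div]
  exact Finset.sum_congr rfl fun j _ => by ring

/-- The covector `X ↦ <X, W>` determines `∂_Wλ` at each critical point: test against the
tangent vector whose derivative of `λ` is concentrated at that point. -/
theorem isUnit_det_etaMatrix (h : InHurwitz k m z) (hk : 0 < k) (hm : 0 < m) :
    IsUnit (etaMatrix k m z).det := by
  rw [isUnit_iff_ne_zero, ne_eq, ← Matrix.exists_mulVec_eq_zero_iff]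
  rintro ⟨W, hW0, hW⟩
  refine hW0 (h.ext_dSuper hk hm fun c hc => ?_)
  have h0 : dSuper k m z 0 c = 0 := by simp [dSuper]
  rw [h0]
  obtain ⟨X, hX⟩ := h.exists_dSuper_eq hk hm (Pi.single c 1)
  have hXW : ∑ i, X i * (etaMatrix k m z).mulVec W i = eta k m z X W := by
    simp only [h.etaMatrix_mulVec hk hm, h.eta_eq hk hm, mul_neg, Finset.sum_neg_distrib,
      Finset.mul_sum]
    rw [Finset.sum_comm]
    congr 1
    refine Finset.sum_congr rfl fun c _ => ?_
    rw [dSuper_eq_sum X, Finset.sum_mul, Finset.sum_div]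
    exact Finset.sum_congr rfl fun j _ => by ring
  rw [hW, h.eta_eq hk hm, Finset.sum_eq_single_of_mem c hc fun b hb hbc => by
    rw [hX b hb, Pi.single_eq_of_ne hbc]; ring, hX c hc] at hXW
  simpa [h.deriv_deriv_superpot_ne_zero hk hm hc] using hXW

theorem dSuper_circ (h : InHurwitz k m z) (hk : 0 < k) (hm : 0 < m) (X Y : Pt k m) {c : ℂ}
    (hc : c ∈ critFinset k m z) :
    dSuper k m z (circ k m z X Y) c = dSuper k m z X c * dSuper k m z Y c := by
  obtain ⟨W, hW⟩ := h.exists_dSuper_eq hk hm fun c => dSuper k m z X c * dSuper k m z Y c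
  have htriple : (fun i => triple k m z X Y (basisVec k m i)) = (etaMatrix k m z).mulVec W := by
    ext i
    rw [h.etaMatrix_mulVec hk hm, h.eta_eq hk hm, h.triple_eq hk hm]
    congr 1
    refine Finset.sum_congr rfl fun c hc => ?_
    rw [hW c hc]
    ring
  rw [circ, htriple, Matrix.mulVec_mulVec,
    Matrix.nonsing_inv_mul _ (h.isUnit_det_etaMatrix hk hm), Matrix.one_mulVec, hW c hc]

/-- By homogeneity `Eλ + (p / k) λ' = λ`, hence `Eλ = λ` at the critical points. -/
theorem dSuper_euler (h : InHurwitz k m z) (hk : 0 < k) (hm : 0 < m) {c : ℂ}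
    (hc : c ∈ critFinset k m z) : dSuper k m z (euler k m z) c = superpot k m z c := by
  have hk0 : (k : ℂ) ≠ 0 := Nat.cast_ne_zero.2 hk.ne'
  have h1 : polarSum (points k m z) (weight k m) (points k m (euler k m z)) c =
      (c * polarSum (points k m z) (weight k m) 1 c - ∑ s, weight k m s) / k := by
    rw [polarSum, polarSum, Finset.mul_sum, ← Finset.sum_sub_distrib, Finset.sum_div]
    refine Finset.sum_congr rfl fun s _ => ?_
    have : c - points k m z s ≠ 0 := sub_ne_zero.2 (h.ne_points hk hm hc s)
    unfold euler
    rw [points_div, Pi.one_apply]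
    field_simp
    ring
  rw [h.dSuper_eq hk hm _ hc, h1, h.polarSum_one_eq_zero hk hm hc, sum_weight]
  field_simp
  ring

/-- The test vector `X` with `∂_Xλ = 1` at all critical points shows that a unity has this
property too. -/
theorem isUnity_iff (h : InHurwitz k m z) (hk : 0 < k) (hm : 0 < m) (e : Pt k m) :
    IsUnity k m z e ↔ ∀ c ∈ critFinset k m z, dSuper k m z e c = 1 := by
  refine ⟨fun he c hc => ?_, fun he X => h.ext_dSuper hk hm fun c hc => ?_⟩
  · obtain ⟨X, hX⟩ := h.exists_dSuper_eq hk hm 1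
    have := h.dSuper_circ hk hm e X hc
    rw [he X, hX c hc] at this
    simpa using this.symm
  · rw [h.dSuper_circ hk hm e X hc, he c hc, one_mul]

/-- In particular the value of `E⁻¹` at `z` is unique. -/
theorem isEulerInv_iff (h : InHurwitz k m z) (hk : 0 < k) (hm : 0 < m) (v : Pt k m) :
    IsEulerInv k m z v ↔
      ∀ c ∈ critFinset k m z, dSuper k m z v c = (superpot k m z c)⁻¹ := by
  rw [IsEulerInv, h.isUnity_iff hk hm]
  refine forall₂_congr fun c hc => ?_
  rw [h.dSuper_circ hk hm _ _ hc, h.dSuper_euler hk hm hc,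
    mul_eq_one_iff_eq_inv₀ (h.superpot_ne_zero hk hm hc)]

theorem exists_isEulerInv (h : InHurwitz k m z) (hk : 0 < k) (hm : 0 < m) :
    ∃ v, IsEulerInv k m z v := by
  obtain ⟨v, hv⟩ := h.exists_dSuper_eq hk hm fun c => (superpot k m z c)⁻¹
  exact ⟨v, (h.isEulerInv_iff hk hm v).2 hv⟩

theorem inter_eq (h : InHurwitz k m z) (hk : 0 < k) (hm : 0 < m) {v : Pt k m}
    (hv : IsEulerInv k m z v) (X Y : Pt k m) :
    inter k m z v X Y = ∑ s, weight k m s * points k m X s * points k m Y s := by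
  have key := sum_weight_mul_polarSum_mul_polarSum (κ := k) (Nat.cast_ne_zero.2 hk.ne')
    sum_weight (fun _ hc => h.polarSum_one_eq_zero hk hm hc)
    (fun _ _ hst => h.sum_critWeight_mul_inv_mul_inv hk hm hst) (points k m X)
    (sum_weight_mul_points hm Y)
  rw [inter, h.eta_eq hk hm, neg_eq_iff_eq_neg, ← key]
  refine Finset.sum_congr rfl fun c hc => ?_
  have hl := h.superpot_ne_zero hk hm hc
  rw [h.dSuper_circ hk hm _ _ hc, (h.isEulerInv_iff hk hm v).1 hv c hc, h.dSuper_eq hk hm X hc,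
    h.dSuper_eq hk hm Y hc, critWeight]
  field_simp

theorem inter_star_eq (h : InHurwitz k m z) (hk : 0 < k) (hm : 0 < m) {v : Pt k m}
    (hv : IsEulerInv k m z v) (X Y Z : Pt k m) :
    inter k m z v (star k m z v X Y) Z =
      (1 / 2) * ∑ s, ∑ t, weight k m s * weight k m t * (points k m X s - points k m X t) *
        (points k m Y s - points k m Y t) * (points k m Z s - points k m Z t) /
          (points k m z s - points k m z t) := by
  have key := sum_weight_mul_polarSum_mul_polarSum_mul_polarSum (κ := k)
    (Nat.cast_ne_zero.2 hk.ne')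
    sum_weight (fun _ hc => h.polarSum_one_eq_zero hk hm hc)
    (fun _ _ hst => h.sum_critWeight_mul_inv_mul_inv hk hm hst) h.points_injective
    (fun _ hc => h.ne_points hk hm hc) (points k m X) (points k m Y)
    (sum_weight_mul_points hm Z)
  rw [inter, h.eta_eq hk hm, ← key, ← Finset.sum_neg_distrib]
  refine Finset.sum_congr rfl fun c hc => ?_
  have hl := h.superpot_ne_zero hk hm hc
  rw [star, h.dSuper_circ hk hm _ _ hc, h.dSuper_circ hk hm _ _ hc, h.dSuper_circ hk hm _ _ hc,
    (h.isEulerInv_iff hk hm v).1 hv c hc, h.dSuper_eq hk hm X hc,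
    h.dSuper_eq hk hm Y hc, h.dSuper_eq hk hm Z hc, critWeight]
  field_simp

end InHurwitz

/-- The Gram matrix `1 - J / m` of the intersection form in the coordinates `z`, where `J` is the
all-ones matrix. -/
noncomputable def interMatrix (k m : ℕ) : Matrix (Fin (k + m)) (Fin (k + m)) ℂ :=
  Matrix.of fun i j => (if i = j then 1 else 0) - 1 / (m : ℂ)

theorem interMatrix_isSymm (k m : ℕ) : (interMatrix k m).IsSymm := by
  ext i j
  simp [interMatrix, eq_comm]

theorem points_basisVec_succ (i j : Fin (k + m)) :
    points k m (basisVec k m i) j.succ = if i = j then 1 else 0 := by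
  simp [basisVec, Pi.single_apply, eq_comm]

theorem points_basisVec_zero (i : Fin (k + m)) :
    points k m (basisVec k m i) 0 = 1 / (m : ℂ) := by
  simp [basisVec, pole]

theorem InHurwitz.inter_basisVec (h : InHurwitz k m z) (hk : 0 < k) (hm : 0 < m) {v : Pt k m}
    (hv : IsEulerInv k m z v) (i j : Fin (k + m)) :
    inter k m z v (basisVec k m i) (basisVec k m j) = interMatrix k m i j := by
  have hm0 : (m : ℂ) ≠ 0 := Nat.cast_ne_zero.2 hm.ne'
  rw [h.inter_eq hk hm hv, Fin.sum_univ_succ]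
  simp only [points_basisVec_succ, points_basisVec_zero, weight_zero, weight_succ, interMatrix,
    Matrix.of_apply, one_mul, ite_mul, zero_mul, Finset.sum_ite_eq, Finset.mem_univ, if_true]
  rw [if_congr (eq_comm (a := j) (b := i)) rfl rfl]
  field_simp
  ring

/-- If `W - (∑ W / m) (1, …, 1) = 0` then summing over the `k + m` entries gives
`-(k / m) ∑ W = 0`. -/
theorem isUnit_det_interMatrix (hk : 0 < k) (hm : 0 < m) : IsUnit (interMatrix k m).det := by
  have hm0 : (m : ℂ) ≠ 0 := Nat.cast_ne_zero.2 hm.ne'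
  have hk0 : (k : ℂ) ≠ 0 := Nat.cast_ne_zero.2 hk.ne'
  rw [isUnit_iff_ne_zero, ne_eq, ← Matrix.exists_mulVec_eq_zero_iff]
  rintro ⟨W, hW0, hW⟩
  have hWi : ∀ i, W i = (∑ j, W j) / m := by
    intro i
    have := congrFun hW i
    simp only [Matrix.mulVec, dotProduct, interMatrix, Matrix.of_apply, sub_mul, ite_mul, one_mul,
      zero_mul, Finset.sum_sub_distrib, Finset.sum_ite_eq, Finset.mem_univ, if_true,
      ← Finset.mul_sum, Pi.zero_apply] at this
    rw [sub_eq_zero.1 this]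
    ring
  have hsum : ∑ j, W j = (k + m) * ((∑ j, W j) / m) := by
    conv_lhs => rw [Finset.sum_congr rfl fun i _ => hWi i]
    simp
  have hS : ∑ j, W j = 0 := by
    field_simp at hsum
    have h2 : (k : ℂ) * ∑ j, W j = 0 := by linear_combination -hsum
    exact (mul_eq_zero.1 h2).resolve_left hk0
  refine hW0 (funext fun i => ?_)
  rw [hWi i, hS, zero_div, Pi.zero_apply]

end FrobeniusStructure

/-! ### Branches of the logarithm -/

section LogBranch

variable {E : Type*} [NormedAddCommGroup E] [NormedSpace ℂ E] {ℓ : E →L[ℂ] ℂ} {L : E → ℂ}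
  {U : Set E} {z : E}

/-- Near a point `z` of `U` a branch `L` equals `log (ℓ² / ℓ(z)²) + L z`, with the principal
branch of `log`. -/
theorem analyticAt_of_exp_eq_sq (hU : IsOpen U) (hL : ContinuousOn L U)
    (hexp : ∀ w ∈ U, Complex.exp (L w) = ℓ w ^ 2) (hz : z ∈ U) (h0 : ℓ z ≠ 0) :
    AnalyticAt ℂ L z := by
  have hcont : ContinuousAt L z := hL.continuousAt (hU.mem_nhds hz)
  have him : ∀ᶠ w in 𝓝 z, |(L w - L z).im| < Real.pi := by
    have h1 : ContinuousAt (fun w => |(L w - L z).im|) z :=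
      (Complex.continuous_im.continuousAt.comp (hcont.sub continuousAt_const)).abs
    refine h1.eventually_lt continuousAt_const ?_
    simpa using Real.pi_pos
  have hev : L =ᶠ[𝓝 z] fun w => Complex.log (ℓ w ^ 2 / ℓ z ^ 2) + L z := by
    filter_upwards [him, hU.mem_nhds hz] with w hw hwU
    rw [← hexp w hwU, ← hexp z hz, ← Complex.exp_sub,
      Complex.log_exp (abs_lt.1 hw).1 (abs_lt.1 hw).2.le, sub_add_cancel]
  refine AnalyticAt.congr ?_ hev.symm
  refine (AnalyticAt.clog ?_ ?_).add analyticAt_const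
  · exact ((ℓ.analyticAt z).pow 2).div analyticAt_const (pow_ne_zero 2 h0)
  · rw [div_self (pow_ne_zero 2 h0)]
    exact Complex.one_mem_slitPlane

theorem hasFDerivAt_of_exp_eq_sq (hU : IsOpen U) (hL : ContinuousOn L U)
    (hexp : ∀ w ∈ U, Complex.exp (L w) = ℓ w ^ 2) (hz : z ∈ U) (h0 : ℓ z ≠ 0) :
    HasFDerivAt L ((2 / ℓ z) • ℓ) z := by
  have h1 := (analyticAt_of_exp_eq_sq hU hL hexp hz h0).differentiableAt.hasFDerivAt
  have h2 : HasFDerivAt (fun w => ℓ w ^ 2) (Complex.exp (L z) • fderiv ℂ L z) z := by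
    refine h1.cexp.congr_of_eventuallyEq ?_
    filter_upwards [hU.mem_nhds hz] with w hw
    exact (hexp w hw).symm
  have h3 := h2.unique (ℓ.hasFDerivAt.pow 2)
  have h4 : fderiv ℂ L z = (2 / ℓ z) • ℓ := by
    ext v
    have h5 := congrArg (fun f : E →L[ℂ] ℂ => f v) h3
    simp only [hexp z hz, smul_apply, smul_eq_mul, nsmul_eq_mul] at h5 ⊢
    field_simp
    refine mul_left_cancel₀ h0 ?_
    linear_combination h5
  rwa [h4] at h1

/-- The derivative of `x² log x²` is `2 (x log x² + x)`. -/
theorem hasFDerivAt_sq_mul (hL : HasFDerivAt L ((2 / ℓ z) • ℓ) z) (h0 : ℓ z ≠ 0) :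
    HasFDerivAt (fun w => ℓ w ^ 2 * L w) ((2 * (ℓ z * L z + ℓ z)) • ℓ) z := by
  refine ((ℓ.hasFDerivAt.pow 2).mul hL).congr_fderiv ?_
  ext v
  simp
  field_simp
  ring

/-- The derivative of `x log x² + x` is `log x² + 3`. -/
theorem hasFDerivAt_mul_add (hL : HasFDerivAt L ((2 / ℓ z) • ℓ) z) (h0 : ℓ z ≠ 0) :
    HasFDerivAt (fun w => ℓ w * L w + ℓ w) ((L z + 3) • ℓ) z := by
  refine ((ℓ.hasFDerivAt.mul hL).add ℓ.hasFDerivAt).congr_fderiv ?_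
  ext v
  simp
  field_simp
  ring

end LogBranch

section Prepotential

variable {k m : ℕ} {U : Set (Pt k m)}

theorem pd_eq_of_hasFDerivAt {F : Pt k m → ℂ} {F' : Pt k m →L[ℂ] ℂ} {z : Pt k m}
    (h : HasFDerivAt F F' z) (i : Fin (k + m)) : pd k m i F z = F' (basisVec k m i) := by
  rw [pd, h.fderiv]

theorem pd_congr {F G : Pt k m → ℂ} (hU : IsOpen U) (h : Set.EqOn F G U) (i : Fin (k + m)) :
    Set.EqOn (pd k m i F) (pd k m i G) U := by
  intro z hz
  rw [pd, pd, (h.eventuallyEq_of_mem (hU.mem_nhds hz)).fderiv_eq]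

theorem analyticOnNhd_pd {F : Pt k m → ℂ} (hF : AnalyticOnNhd ℂ F U) (i : Fin (k + m)) :
    AnalyticOnNhd ℂ (pd k m i F) U :=
  (ContinuousLinearMap.apply ℂ ℂ (basisVec k m i)).comp_analyticOnNhd hF.fderiv

theorem pd_sub {F G : Pt k m → ℂ} (hF : AnalyticOnNhd ℂ F U) (hG : AnalyticOnNhd ℂ G U)
    (i : Fin (k + m)) :
    Set.EqOn (pd k m i fun w => F w - G w) (fun w => pd k m i F w - pd k m i G w) U := by
  intro z hz
  simp only [pd]
  rw [fderiv_fun_sub (hF z hz).differentiableAt (hG z hz).differentiableAt]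
  rfl

/-- The coordinate difference `z^s - z^t` as a linear form. -/
noncomputable def pointsDiff (k m : ℕ) (s t : Fin (k + m + 1)) : Pt k m →L[ℂ] ℂ :=
  LinearMap.toContinuousLinearMap
    { toFun := fun z => points k m z s - points k m z t
      map_add' := by
        have h : ∀ (X Y : Pt k m) (s), points k m (X + Y) s = points k m X s + points k m Y s := by
          intro X Y s
          refine Fin.cases ?_ (fun i => rfl) s
          simpa using pole_add_smul X Y 1
        intro X Y
        rw [h, h]
        ring
      map_smul' := by
        have h : ∀ (a : ℂ) (X : Pt k m) (s), points k m (a • X) s = a * points k m X s := by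
          intro a X s
          refine Fin.cases ?_ (fun i => rfl) s
          simpa [pole] using pole_add_smul 0 X a
        intro a X
        rw [h, h, RingHom.id_apply, smul_eq_mul]
        ring }

theorem pointsDiff_apply (s t : Fin (k + m + 1)) (z : Pt k m) :
    pointsDiff k m s t z = points k m z s - points k m z t := rfl

/-! ### Third derivatives of the prepotential -/

section DualF

variable {L : Fin (k + m + 1) → Fin (k + m + 1) → Pt k m → ℂ}

theorem pointsDiff_ne_zero {z : Pt k m} (h : InHurwitz k m z) {s t : Fin (k + m + 1)}
    (hst : s < t) : pointsDiff k m s t z ≠ 0 :=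
  sub_ne_zero.2 (h.points_injective.ne hst.ne)

theorem dualF_eq (z : Pt k m) : dualF k m L z = ∑ s, ∑ t ∈ Finset.Ioi s,
    (1 / 4) * (weight k m s * weight k m t) * (pointsDiff k m s t z ^ 2 * L s t z) := by
  rw [dualF, Finset.mul_sum]
  refine Finset.sum_congr rfl fun s _ => ?_
  rw [Finset.mul_sum]
  refine Finset.sum_congr rfl fun t _ => ?_
  rw [pointsDiff_apply]
  ring

theorem analyticOnNhd_dualF (hU : IsOpen U) (hH : ∀ z ∈ U, InHurwitz k m z)
    (hL : IsLogBranch k m U L) : AnalyticOnNhd ℂ (dualF k m L) U := by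
  intro z hz
  rw [funext dualF_eq]
  refine Finset.analyticAt_fun_sum _ fun s _ => Finset.analyticAt_fun_sum _ fun t ht => ?_
  have hst := Finset.mem_Ioi.1 ht
  have h1 : AnalyticAt ℂ (L s t) z := analyticAt_of_exp_eq_sq (ℓ := pointsDiff k m s t) hU
    (hL s t hst).1 (hL s t hst).2 hz (pointsDiff_ne_zero (hH z hz) hst)
  exact analyticAt_const.mul ((((pointsDiff k m s t).analyticAt z).pow 2).mul h1)

/-- Termwise differentiation of a sum over pairs. -/
theorem pd_sum_pairs {G : Fin (k + m + 1) → Fin (k + m + 1) → Pt k m → ℂ}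
    {G' : Fin (k + m + 1) → Fin (k + m + 1) → ℂ} {z : Pt k m}
    (a : Fin (k + m + 1) → Fin (k + m + 1) → ℂ)
    (hG : ∀ s t, s < t → HasFDerivAt (G s t) (G' s t • pointsDiff k m s t) z)
    (i : Fin (k + m)) :
    pd k m i (fun w => ∑ s, ∑ t ∈ Finset.Ioi s, a s t * G s t w) z =
      ∑ s, ∑ t ∈ Finset.Ioi s,
        a s t * (G' s t * pointsDiff k m s t (basisVec k m i)) := by
  have h : HasFDerivAt (fun w => ∑ s, ∑ t ∈ Finset.Ioi s, a s t * G s t w)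
      (∑ s, ∑ t ∈ Finset.Ioi s, a s t • (G' s t • pointsDiff k m s t)) z :=
    HasFDerivAt.fun_sum fun s _ => HasFDerivAt.fun_sum fun t ht =>
      (hG s t (Finset.mem_Ioi.1 ht)).const_mul (a s t)
  rw [pd_eq_of_hasFDerivAt h]
  simp

theorem pd_pd_pd_dualF (hU : IsOpen U) (hH : ∀ z ∈ U, InHurwitz k m z)
    (hL : IsLogBranch k m U L) {z : Pt k m} (hz : z ∈ U) (i j l : Fin (k + m)) :
    pd k m i (pd k m j (pd k m l (dualF k m L))) z =
      ∑ s, ∑ t ∈ Finset.Ioi s, weight k m s * weight k m t *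
        pointsDiff k m s t (basisVec k m i) * pointsDiff k m s t (basisVec k m j) *
          pointsDiff k m s t (basisVec k m l) / pointsDiff k m s t z := by
  have hne : ∀ w ∈ U, ∀ s t, s < t → pointsDiff k m s t w ≠ 0 :=
    fun w hw s t hst => pointsDiff_ne_zero (hH w hw) hst
  have hd : ∀ w ∈ U, ∀ s t, s < t →
      HasFDerivAt (L s t) ((2 / pointsDiff k m s t w) • pointsDiff k m s t) w :=
    fun w hw s t hst => hasFDerivAt_of_exp_eq_sq hU (hL s t hst).1 (hL s t hst).2 hw
      (hne w hw s t hst)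
  have h1 : Set.EqOn (pd k m l (dualF k m L)) (fun w => ∑ s, ∑ t ∈ Finset.Ioi s,
      (1 / 2) * (weight k m s * weight k m t * pointsDiff k m s t (basisVec k m l)) *
        (pointsDiff k m s t w * L s t w + pointsDiff k m s t w)) U := by
    intro w hw
    rw [funext dualF_eq, pd_sum_pairs _ fun s t hst =>
      hasFDerivAt_sq_mul (hd w hw s t hst) (hne w hw s t hst)]
    exact Finset.sum_congr rfl fun s _ => Finset.sum_congr rfl fun t _ => by ring
  have h2 : Set.EqOn (pd k m j (pd k m l (dualF k m L))) (fun w => ∑ s, ∑ t ∈ Finset.Ioi s,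
      (1 / 2) * (weight k m s * weight k m t * pointsDiff k m s t (basisVec k m l) *
        pointsDiff k m s t (basisVec k m j)) * (L s t w + 3)) U := by
    intro w hw
    rw [pd_congr hU h1 j hw, pd_sum_pairs _ fun s t hst =>
      hasFDerivAt_mul_add (hd w hw s t hst) (hne w hw s t hst)]
    exact Finset.sum_congr rfl fun s _ => Finset.sum_congr rfl fun t _ => by ring
  rw [pd_congr hU h2 i hz, pd_sum_pairs _ fun s t hst => (hd z hz s t hst).add_const 3]
  exact Finset.sum_congr rfl fun s _ => Finset.sum_congr rfl fun t _ => by ring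

/-- Passage to the pairs `s < t`: the summand is symmetric, and its numerator vanishes on the
diagonal. -/
theorem InHurwitz.inter_star_basisVec {z v : Pt k m} (h : InHurwitz k m z) (hk : 0 < k)
    (hm : 0 < m) (hv : IsEulerInv k m z v) (i j l : Fin (k + m)) :
    inter k m z v (star k m z v (basisVec k m i) (basisVec k m j)) (basisVec k m l) =
      ∑ s, ∑ t ∈ Finset.Ioi s, weight k m s * weight k m t *
        pointsDiff k m s t (basisVec k m i) * pointsDiff k m s t (basisVec k m j) *
          pointsDiff k m s t (basisVec k m l) / pointsDiff k m s t z := by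
  rw [h.inter_star_eq hk hm hv]
  set f : Fin (k + m + 1) → Fin (k + m + 1) → ℂ := fun s t => weight k m s * weight k m t *
    pointsDiff k m s t (basisVec k m i) * pointsDiff k m s t (basisVec k m j) *
      pointsDiff k m s t (basisVec k m l) / pointsDiff k m s t z with hf
  have hsymm : ∀ s t, f t s = f s t := by
    intro s t
    have : ∀ X, pointsDiff k m t s X = -pointsDiff k m s t X := by
      intro X
      simp only [pointsDiff_apply]
      ring
    simp only [hf, this, div_neg]
    ring
  have hdiag : ∀ s, f s s = 0 := by
    intro s
    simp [hf, pointsDiff_apply]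
  change (1 / 2) * ∑ s, ∑ t, f s t = ∑ s, ∑ t ∈ Finset.Ioi s, f s t
  have h1 : ∑ s, ∑ t, f s t = ∑ s, ∑ t ∈ {s}ᶜ, f t s := by
    refine Finset.sum_congr rfl fun s _ => ?_
    rw [Fintype.sum_eq_add_sum_compl s, hdiag, zero_add]
    exact Finset.sum_congr rfl fun t _ => (hsymm s t).symm
  rw [h1, ← Finset.sum_sum_Ioi_add_eq_sum_sum_off_diag, Finset.mul_sum]
  refine Finset.sum_congr rfl fun s _ => ?_
  rw [Finset.mul_sum]
  refine Finset.sum_congr rfl fun t _ => ?_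
  rw [hsymm]
  ring

end DualF

/-! ### Functions with vanishing third derivatives -/

section Quadratic

variable {F : Pt k m → ℂ}

theorem eq_const_of_pd_eq_zero (hU : IsOpen U) (hU' : IsPreconnected U)
    (hF : DifferentiableOn ℂ F U) (h : ∀ z ∈ U, ∀ i, pd k m i F z = 0) :
    ∃ a, ∀ z ∈ U, F z = a := by
  refine hU.exists_is_const_of_fderiv_eq_zero hU' hF fun z hz => ?_
  ext X
  rw [clm_apply_eq_sum]
  exact Finset.sum_eq_zero fun i _ => by
    have := h z hz i
    rw [pd] at this
    rw [this, zero_mul]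

theorem pd_pd_comm {z : Pt k m} (hF : AnalyticAt ℂ F z) (i j : Fin (k + m)) :
    pd k m i (pd k m j F) z = pd k m j (pd k m i F) z := by
  have key : ∀ i j, pd k m i (pd k m j F) z =
      fderiv ℂ (fderiv ℂ F) z (basisVec k m i) (basisVec k m j) := by
    intro i j
    have h1 : HasFDerivAt (pd k m j F)
        ((ContinuousLinearMap.apply ℂ ℂ (basisVec k m j)).comp (fderiv ℂ (fderiv ℂ F) z)) z :=
      (ContinuousLinearMap.apply ℂ ℂ (basisVec k m j)).hasFDerivAt.comp z
        hF.fderiv.differentiableAt.hasFDerivAt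
    rw [pd_eq_of_hasFDerivAt h1]
    rfl
  rw [key, key]
  exact (hF.contDiffAt (n := ⊤)).isSymmSndFDerivAt_of_omega _ _

theorem hasFDerivAt_sum_mul_apply (b : Fin (k + m) → ℂ) (z : Pt k m) :
    HasFDerivAt (fun w : Pt k m => ∑ i, b i * w i)
      (∑ i, b i • (ContinuousLinearMap.proj i : Pt k m →L[ℂ] ℂ)) z :=
  HasFDerivAt.fun_sum fun i _ => (hasFDerivAt_apply i z).const_mul (b i)

theorem pd_sum_mul_apply (b : Fin (k + m) → ℂ) (z : Pt k m) (l : Fin (k + m)) :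
    pd k m l (fun w : Pt k m => ∑ i, b i * w i) z = b l := by
  rw [pd_eq_of_hasFDerivAt (hasFDerivAt_sum_mul_apply b z)]
  simp [basisVec, Pi.single_apply]

theorem pd_sum_sum_mul_apply (Q : Fin (k + m) → Fin (k + m) → ℂ) (z : Pt k m)
    (l : Fin (k + m)) :
    pd k m l (fun w : Pt k m => ∑ i, ∑ j, Q i j * w i * w j) z =
      ∑ j, (Q j l + Q l j) * z j := by
  have h : HasFDerivAt (fun w : Pt k m => ∑ i, ∑ j, Q i j * w i * w j)
      (∑ i, ∑ j, ((Q i j * z i) • (ContinuousLinearMap.proj j : Pt k m →L[ℂ] ℂ) +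
        z j • (Q i j • (ContinuousLinearMap.proj i : Pt k m →L[ℂ] ℂ)))) z :=
    HasFDerivAt.fun_sum fun i _ => HasFDerivAt.fun_sum fun j _ =>
      ((hasFDerivAt_apply i z).const_mul (Q i j)).mul (hasFDerivAt_apply j z)
  rw [pd_eq_of_hasFDerivAt h]
  simp only [sum_apply, add_apply, smul_apply, ContinuousLinearMap.proj_apply, basisVec, Pi.single_apply,
    smul_eq_mul, mul_ite, mul_one, mul_zero, Finset.sum_add_distrib, Finset.sum_ite_eq',
    Finset.mem_univ, if_true, add_mul]
  congr 1
  rw [Finset.sum_comm]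
  simp only [Finset.sum_ite_eq', Finset.mem_univ, if_true]
  exact Finset.sum_congr rfl fun j _ => mul_comm _ _

/-- The second derivatives are constants `A i j`; the factor `1 / 2` in the quadratic part uses
their symmetry. -/
theorem eq_quadratic_of_pd_pd_pd_eq_zero (hU : IsOpen U) (hU' : IsPreconnected U)
    (hF : AnalyticOnNhd ℂ F U)
    (h : ∀ z ∈ U, ∀ i j l, pd k m i (pd k m j (pd k m l F)) z = 0) :
    ∃ (a : ℂ) (b : Fin (k + m) → ℂ) (Q : Fin (k + m) → Fin (k + m) → ℂ),
      ∀ z ∈ U, F z = a + ∑ i, b i * z i + ∑ i, ∑ j, Q i j * z i * z j := by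
  rcases U.eq_empty_or_nonempty with rfl | ⟨z₀, hz₀⟩
  · exact ⟨0, 0, 0, fun z hz => hz.elim⟩
  have hF1 : ∀ l, AnalyticOnNhd ℂ (pd k m l F) U := analyticOnNhd_pd hF
  have hproj : ∀ i (z : Pt k m), AnalyticAt ℂ (fun w : Pt k m => w i) z :=
    fun i z => (ContinuousLinearMap.proj i : Pt k m →L[ℂ] ℂ).analyticAt z
  have hlin : ∀ b : Fin (k + m) → ℂ, AnalyticOnNhd ℂ (fun w : Pt k m => ∑ i, b i * w i) U := by
    exact fun b z _ => Finset.analyticAt_fun_sum _ fun i _ => analyticAt_const.mul (hproj i z)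
  have hquad : ∀ Q : Fin (k + m) → Fin (k + m) → ℂ,
      AnalyticOnNhd ℂ (fun w : Pt k m => ∑ i, ∑ j, Q i j * w i * w j) U := by
    exact fun Q z _ => Finset.analyticAt_fun_sum _ fun i _ => Finset.analyticAt_fun_sum _ fun j _ =>
      (analyticAt_const.mul (hproj i z)).mul (hproj j z)
  have hconst2 : ∀ j l, ∃ a, ∀ z ∈ U, pd k m j (pd k m l F) z = a := fun j l =>
    eq_const_of_pd_eq_zero hU hU' (analyticOnNhd_pd (hF1 l) j).differentiableOn
      fun z hz i => h z hz i j l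
  choose A hA using hconst2
  have hAsymm : ∀ j l, A j l = A l j := fun j l => by
    rw [← hA j l z₀ hz₀, ← hA l j z₀ hz₀, pd_pd_comm (hF z₀ hz₀)]
  have hconst1 : ∀ l, ∃ a, ∀ z ∈ U, pd k m l F z - ∑ j, A j l * z j = a := by
    intro l
    refine eq_const_of_pd_eq_zero hU hU' ((hF1 l).sub (hlin _)).differentiableOn
      fun z hz i => ?_
    rw [pd_sub (hF1 l) (hlin _) i hz]
    simp only [pd_sum_mul_apply, hA i l z hz, sub_self]
  choose b hb using hconst1
  have hdiff := pd_sub hF (hlin b)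
  have hconst0 : ∃ a, ∀ z ∈ U, F z - ∑ i, b i * z i -
      ∑ i, ∑ j, (1 / 2 * A i j) * z i * z j = a := by
    refine eq_const_of_pd_eq_zero hU hU'
      ((hF.sub (hlin b)).sub (hquad _)).differentiableOn fun z hz l => ?_
    refine (pd_sub (hF.sub (hlin b)) (hquad _) l hz).trans ?_
    change pd k m l (fun w => F w - ∑ i, b i * w i) z - _ = 0
    rw [hdiff l hz, pd_sum_sum_mul_apply]
    simp only [pd_sum_mul_apply]
    rw [← hb l z hz, sub_sub_cancel, sub_eq_zero]
    refine Finset.sum_congr rfl fun j _ => ?_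
    rw [hAsymm l j]
    ring
  obtain ⟨a, ha⟩ := hconst0
  refine ⟨a, b, fun i j => 1 / 2 * A i j, fun z hz => ?_⟩
  rw [← ha z hz]
  ring

end Quadratic

end Prepotential

end HurwitzDual

theorem mainTheorem3 (k m : ℕ) (hk : 0 < k) (hm : 0 < m)
    (U : Set (HurwitzDual.Pt k m)) (hU : IsOpen U)
    (hH : ∀ z ∈ U, HurwitzDual.InHurwitz k m z)
    (L : Fin (k + m + 1) → Fin (k + m + 1) → HurwitzDual.Pt k m → ℂ)
    (hL : HurwitzDual.IsLogBranch k m U L) :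
    HurwitzDual.IsDualPrepotential k m U (HurwitzDual.dualF k m L) ∧
    (IsPreconnected U → ∀ F : HurwitzDual.Pt k m → ℂ,
      HurwitzDual.IsDualPrepotential k m U F →
        ∃ (a : ℂ) (b : Fin (k + m) → ℂ) (Q : Fin (k + m) → Fin (k + m) → ℂ),
          ∀ z ∈ U, F z = HurwitzDual.dualF k m L z + a + ∑ i, b i * z i +
            ∑ i, ∑ j, Q i j * z i * z j) := by
  open HurwitzDual in
  have hG := analyticOnNhd_dualF hU hH hL
  refine ⟨⟨hG, fun z hz => (hH z hz).isUnit_det_etaMatrix hk hm, ?_⟩, fun hU' F hF => ?_⟩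
  · have hex : ∀ z, ∃ v, z ∈ U → IsEulerInv k m z v := by
      intro z
      by_cases hz : z ∈ U
      · obtain ⟨v, hv⟩ := (hH z hz).exists_isEulerInv hk hm
        exact ⟨v, fun _ => hv⟩
      · exact ⟨0, fun hz' => absurd hz' hz⟩
    choose v hv using hex
    refine ⟨v, hv, ⟨interMatrix k m, interMatrix_isSymm k m, isUnit_det_interMatrix hk hm,
      fun z hz i j => (hH z hz).inter_basisVec hk hm (hv z hz) i j⟩, fun z hz i j l => ?_⟩
    rw [pd_pd_pd_dualF hU hH hL hz, (hH z hz).inter_star_basisVec hk hm (hv z hz)]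
  · obtain ⟨v, hv, -, hstar⟩ := hF.structure_eq
    have hF1 := hF.analytic
    have h1 := pd_sub hF1 hG
    have h2 := fun l => pd_sub (analyticOnNhd_pd hF1 l) (analyticOnNhd_pd hG l)
    have h3 := fun j l => pd_sub (analyticOnNhd_pd (analyticOnNhd_pd hF1 l) j)
      (analyticOnNhd_pd (analyticOnNhd_pd hG l) j)
    obtain ⟨a, b, Q, hQ⟩ := eq_quadratic_of_pd_pd_pd_eq_zero hU hU' (hF1.sub hG)
      fun z hz i j l => by
        have e1 := pd_congr hU (pd_congr hU (h1 l) j) i hz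
        have e2 := pd_congr hU (h2 l j) i hz
        refine e1.trans (e2.trans ((h3 j l i hz).trans ?_))
        simp only
        rw [hstar z hz, pd_pd_pd_dualF hU hH hL hz,
          (hH z hz).inter_star_basisVec hk hm (hv z hz), sub_self]
    refine ⟨a, b, Q, fun z hz => ?_⟩
    have := hQ z hz
    rw [Pi.sub_apply] at this
    linear_combination this
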